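/- Let $(X,\mathcal S)$ be a standard Borel space, let $\mu$ be a finite nonatomic measure on it, and let $T\colon X\to X$ be a measure-preserving (not necessarily invertible) transformation that is ergodic, i.e. every $A\in\mathcal S$ with $T^{-1}(A)=A$ satisfies $\mu(A)=0$ or $\mu(X\setminus A)=0$. A metric $d$ on $X$ is called \emph{$\mu$-compatible} if it is measurable on $X\times X$ with respect to $\mathcal S\otimes\mathcal S$, it is bounded by $1$, and every nonempty open $d$-ball has positive $\mu$-measure. The system $(X,\mu,T)$ is called \emph{Li-Yorke M-sensitive} if for every $\mu$-compatible metric $d$ on $X$ one has $$\liminf_{n\to\infty} d(T^nx,T^ny)=0\quad\text{and}\quad \limsup_{n\to\infty} d(T^nx,T^ny)>0$$ for $\mu\times\mu$-almost every pair $(x,y)\in X\times X$. It is called \emph{weakly mixing} if, whenever $z\in\mathbb C$ and $f\in L^\infty(X,\mu;\mathbb C)$ satisfy $f\circ T=zf$ $\mu$-almost everywhere, $f$ is constant $\mu$-almost everywhere. Then $T$ is Li-Yorke M-sensitive if and only if it is weakly mixing. -/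

import Mathlib

open MeasureTheory Filter

namespace MeasurableLiYorke

/-- The metric of `X` is `μ`-compatible: it is measurable on `X × X` for the product of the given
σ-algebra with itself, it is bounded by `1`, and nonempty open balls have positive measure.
(No relation between the σ-algebra and the topology of the metric is assumed.) -/
structure IsCompatibleMetric {X : Type*} [MeasurableSpace X] [MetricSpace X]
    (μ : Measure X) : Prop where
  measurable_dist : Measurable (fun p : X × X => dist p.1 p.2)
  dist_le_one : ∀ x y : X, dist x y ≤ 1
  ball_pos : ∀ (x : X) (r : ℝ), 0 < r → 0 < μ (Metric.ball x r)

/-- `(x, y)` is a Li-Yorke pair of `T`. It is used for metrics bounded by `1` only, so that the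
real `liminf` and `limsup` are those of a bounded sequence. -/
def IsLiYorkePair {X : Type*} [MetricSpace X] (T : X → X) (x y : X) : Prop :=
  liminf (fun n : ℕ => dist (T^[n] x) (T^[n] y)) atTop = 0 ∧
    0 < limsup (fun n : ℕ => dist (T^[n] x) (T^[n] y)) atTop

/-- Li-Yorke measurable sensitivity for one metric: almost every pair is a Li-Yorke pair. -/
def LiYorkeMSensitiveFor {X : Type*} [MeasurableSpace X] [MetricSpace X]
    (T : X → X) (μ : Measure X) : Prop :=
  ∀ᵐ p ∂(μ.prod μ), IsLiYorkePair T p.1 p.2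

/-- Li-Yorke M-sensitivity: Li-Yorke measurable sensitivity for every `μ`-compatible metric
on `X`. -/
def LiYorkeMSensitive {X : Type*} [MeasurableSpace X] (T : X → X) (μ : Measure X) : Prop :=
  ∀ [MetricSpace X], IsCompatibleMetric μ → LiYorkeMSensitiveFor T μ

/-- Weak mixing: every bounded measurable eigenfunction is constant almost everywhere. -/
def WeaklyMixing {X : Type*} [MeasurableSpace X] (T : X → X) (μ : Measure X) : Prop :=
  ∀ (z : ℂ) (f : X → ℂ), MemLp f ⊤ μ → (∀ᵐ x ∂μ, f (T x) = z * f x) →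
    ∃ c : ℂ, ∀ᵐ x ∂μ, f x = c

end MeasurableLiYorke

/-! Weak mixing makes `T × T` ergodic. For an invariant set `A`, the section at `x` is the preimage
under `T` of the section at `T x`, so the indicators of sections, minus their means, intertwine `T`
with the Koopman isometry. Their covariance operator is compact and commutes with the isometry, so a
nonzero eigenvalue would yield a Koopman eigenvector; such a vector is constant, hence orthogonal to
the centred indicators (`ae_eq_zero_of_orthogonal_eigenvectors`). Sections are therefore null or
conull. Recurrence under `T × T` then brings almost every pair arbitrarily close, and a fixed
distance apart, infinitely often.

Conversely, an eigenfunction `f` has an eigenvalue of modulus one, so the difference of its values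
along two orbits has constant modulus. A compatible metric dominating this difference
(`exists_isCompatibleMetric_ge`) has liminf zero only if `f` agrees at both points. -/

namespace MeasurableLiYorke

/-! ### Covariance operators and eigenvectors of isometries -/

section Hilbert

variable {H : Type*} [NormedAddCommGroup H] [InnerProductSpace ℂ H]

lemma isCompactOperator_rankOne (u v : H) :
    IsCompactOperator (InnerProductSpace.rankOne ℂ u v) := by
  rw [InnerProductSpace.rankOne_def']
  have h : IsCompactOperator (innerSL ℂ v : H →L[ℂ] ℂ) :=
    (isCompactOperator_id (E := ℂ)).comp_clm (innerSL ℂ v)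
  exact h.clm_comp (ContinuousLinearMap.toSpanSingleton ℂ u)

lemma continuous_rankOne_self :
    Continuous (fun v : H => (InnerProductSpace.rankOne ℂ v v : H →L[ℂ] H)) :=
  ((ContinuousLinearMap.smulRightL ℂ H H).continuous.comp
    (innerSL ℂ (E := H)).continuous).clm_apply continuous_id

variable {X : Type*} [MeasurableSpace X] {μ : Measure X} [IsFiniteMeasure μ]

lemma integrable_rankOne_self {Φ : X → H} (hΦ : AEStronglyMeasurable Φ μ) {M : ℝ}
    (hM : ∀ᵐ x ∂μ, ‖Φ x‖ ≤ M) :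
    Integrable (fun x => (InnerProductSpace.rankOne ℂ (Φ x) (Φ x) : H →L[ℂ] H)) μ := by
  refine Integrable.of_bound (continuous_rankOne_self.comp_aestronglyMeasurable hΦ) (M * M) ?_
  filter_upwards [hM] with x hx
  rw [InnerProductSpace.norm_rankOne]
  exact mul_self_le_mul_self (norm_nonneg _) hx

/-- Compact operators form a closed, hence complete, subspace, so the integral can be taken inside
it. -/
lemma isCompactOperator_integral_rankOne_self [CompleteSpace H] {Φ : X → H} (hΦ : AEStronglyMeasurable Φ μ) {M : ℝ}
    (hM : ∀ᵐ x ∂μ, ‖Φ x‖ ≤ M) :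
    IsCompactOperator
      (∫ x, (InnerProductSpace.rankOne ℂ (Φ x) (Φ x) : H →L[ℂ] H) ∂μ : H →L[ℂ] H) := by
  let K := compactOperator (RingHom.id ℂ) H H
  have hK : IsClosed (K : Set (H →L[ℂ] H)) := isClosed_setOfPred_isCompactOperator
  have : CompleteSpace K := hK.completeSpace_coe
  let g : X → K := fun x => ⟨InnerProductSpace.rankOne ℂ (Φ x) (Φ x), isCompactOperator_rankOne _ _⟩
  have hc : Continuous (fun v : H =>
      (⟨InnerProductSpace.rankOne ℂ v v, isCompactOperator_rankOne _ _⟩ : K)) :=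
    continuous_rankOne_self.subtype_mk _
  have hg : Integrable g μ := by
    refine ⟨hc.comp_aestronglyMeasurable hΦ, ?_⟩
    exact (integrable_rankOne_self hΦ hM).2
  have := K.subtypeL.integral_comp_comm hg
  simp only [Submodule.subtypeL_apply, g] at this
  rw [this]
  exact (∫ x, g x ∂μ).2

/-- If a bounded function `Φ` with values in a Hilbert space intertwines a measure preserving map
with a linear isometry, and is orthogonal to all eigenvectors of the isometry, it vanishes. -/
theorem ae_eq_zero_of_orthogonal_eigenvectors [CompleteSpace H] [SecondCountableTopology H]
    {T : X → X} (hT : MeasurePreserving T μ μ) (U : H →ₗᵢ[ℂ] H) {Φ : X → H}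
    (hΦ : AEStronglyMeasurable Φ μ) {M : ℝ} (hM : ∀ᵐ x ∂μ, ‖Φ x‖ ≤ M)
    (hU : ∀ᵐ x ∂μ, U (Φ (T x)) = Φ x)
    (horth : ∀ (z : ℂ) (f : H), U f = z • f → ∀ᵐ x ∂μ, inner ℂ (Φ x) f = 0) :
    Φ =ᵐ[μ] 0 := by
  set C : H →L[ℂ] H := ∫ x, (InnerProductSpace.rankOne ℂ (Φ x) (Φ x) : H →L[ℂ] H) ∂μ with hC
  have hint := integrable_rankOne_self (μ := μ) hΦ hM
  have hCapp (f : H) : C f = ∫ x, inner ℂ (Φ x) f • Φ x ∂μ := by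
    rw [hC, ContinuousLinearMap.integral_apply hint]
    rfl
  have hint' (f : H) : Integrable (fun x => inner ℂ (Φ x) f • Φ x) μ :=
    hint.apply_continuousLinearMap f
  have hinner (f g : H) : inner ℂ g (C f) = ∫ x, inner ℂ (Φ x) f * inner ℂ g (Φ x) ∂μ := by
    rw [hCapp, ← integral_inner (hint' f)]
    simp only [inner_smul_right]
  have hCcomp : IsCompactOperator C := isCompactOperator_integral_rankOne_self hΦ hM
  have hCsymm : C.IsSymmetric := by
    intro f g
    change inner ℂ (C f) g = inner ℂ f (C g)
    rw [← inner_conj_symm, hinner, hinner, ← integral_conj]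
    refine integral_congr_ae (.of_forall fun x => ?_)
    simp [mul_comm]
  have hcomm (f : H) : C (U f) = U (C f) := by
    have hUc := U.toContinuousLinearMap.integral_comp_comm (hint' f)
    rw [hCapp, hCapp]
    change _ = U.toContinuousLinearMap _
    rw [← hUc]
    -- Invariance of `μ` allows replacing `x` by `T x`, after which `hU` removes `U`.
    have hmap : ∫ x, inner ℂ (Φ x) f • U (Φ x) ∂μ
        = ∫ x, inner ℂ (Φ (T x)) f • U (Φ (T x)) ∂μ := by
      conv_lhs => rw [← hT.map_eq]
      refine integral_map hT.aemeasurable ?_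
      rw [hT.map_eq]
      exact (hΦ.inner aestronglyMeasurable_const).smul
        (U.continuous.comp_aestronglyMeasurable hΦ)
    simp only [LinearIsometry.coe_toContinuousLinearMap, map_smul]
    rw [hmap]
    refine integral_congr_ae ?_
    filter_upwards [hU] with x hx
    rw [hx, ← U.inner_map_map (Φ (T x)) f, hx]
  have hC0 : C = 0 := by
    rw [← ContinuousLinearMap.eq_zero_of_forall_hasEigenvalue_eq_zero hCcomp hCsymm]
    intro l hl
    by_contra hl0
    -- `E` is finite-dimensional and `U`-invariant, so it contains an eigenvector of `U`;
    -- orthogonality to `Φ` makes `C` kill it.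
    let E := Module.End.eigenspace C.toLinearMap l
    have hfin : FiniteDimensional ℂ E :=
      ContinuousLinearMap.finite_dimensional_eigenspace hCcomp l hl0
    have hnt : Nontrivial E := (Submodule.nontrivial_iff_ne_bot).2 hl
    have hUE : ∀ f ∈ E, U.toLinearMap f ∈ E := by
      intro f hf
      rw [Module.End.mem_eigenspace_iff] at hf ⊢
      change C (U f) = l • U f
      rw [hcomm, show C f = l • f from hf, map_smul]
    obtain ⟨z, hz⟩ := Module.End.exists_eigenvalue (U.toLinearMap.restrict hUE)
    obtain ⟨f, hf⟩ := hz.exists_hasEigenvector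
    have hUf : U (f : H) = z • (f : H) := congrArg Subtype.val hf.apply_eq_smul
    have hCf : C f = l • (f : H) := Module.End.mem_eigenspace_iff.1 f.2
    have : C f = 0 := by
      rw [hCapp]
      refine integral_eq_zero_of_ae ?_
      filter_upwards [horth z f hUf] with x hx
      simp [hx]
    rw [this, eq_comm, smul_eq_zero] at hCf
    exact hf.2 (Subtype.ext (hCf.resolve_left hl0))
  refine ae_eq_zero_of_forall_inner (𝕜 := ℂ) fun f => ?_
  have h0 : ∫ x, inner ℂ (Φ x) f * inner ℂ f (Φ x) ∂μ = 0 := by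
    rw [← hinner, hC0]; simp
  have h1 : ∫ x, ‖inner ℂ f (Φ x)‖ ^ 2 ∂μ = 0 := by
    have : ∀ x, inner ℂ (Φ x) f * inner ℂ f (Φ x) = ((‖inner ℂ f (Φ x)‖ ^ 2 : ℝ) : ℂ) := by
      intro x
      rw [← inner_conj_symm (Φ x) f, RCLike.conj_mul]
      simp
    simp only [this] at h0
    rw [integral_complex_ofReal] at h0
    exact_mod_cast h0
  have hi : Integrable (fun x => ‖inner ℂ f (Φ x)‖ ^ 2) μ := by
    refine Integrable.of_bound (C := (‖f‖ * M) ^ 2) ?_ ?_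
    · exact ((aestronglyMeasurable_const.inner hΦ).norm.pow 2)
    · filter_upwards [hM] with x hx
      rw [Real.norm_of_nonneg (by positivity)]
      gcongr
      exact (norm_inner_le_norm _ _).trans (by gcongr)
  rw [integral_eq_zero_iff_of_nonneg (fun x => by positivity) hi] at h1
  filter_upwards [h1] with x hx
  simpa using hx

end Hilbert

/-- A map to a second countable metric space is measurable as soon as its distance to each point
is measurable. -/
lemma measurable_of_edist {X Y : Type*} [MeasurableSpace X] [PseudoEMetricSpace Y]
    [SecondCountableTopology Y] [MeasurableSpace Y] [BorelSpace Y] {f : X → Y}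
    (h : ∀ y, Measurable fun x => edist (f x) y) : Measurable f := by
  refine measurable_of_isOpen fun U hU => ?_
  choose! r hr0 hr using EMetric.isOpen_iff.1 hU
  obtain ⟨t, htU, ht, hteq⟩ := TopologicalSpace.countable_cover_nhdsWithin (s := U)
    (f := fun y => Metric.eball y (r y))
    fun y hy => mem_nhdsWithin_of_mem_nhds (Metric.eball_mem_nhds y (hr0 y hy))
  have : U = ⋃ y ∈ t, Metric.eball y (r y) :=
    hteq.antisymm (Set.iUnion₂_subset fun y hy => hr y (htU hy))
  rw [this, Set.preimage_iUnion₂]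
  exact .biUnion ht fun y _ => measurableSet_lt (h y) measurable_const

/-! ### Weak mixing implies double ergodicity -/

section Sections

instance : Fact ((2 : ENNReal) ≠ ⊤) := ⟨ENNReal.ofNat_ne_top⟩

variable {X : Type*} [MeasurableSpace X] {μ : Measure X}

variable {T : X → X}

lemma measure_section_comp (hT : MeasurePreserving T μ μ) {A : Set (X × X)}
    (hA : MeasurableSet A) (hAT : Prod.map T T ⁻¹' A = A) (x : X) :
    μ (Prod.mk (T x) ⁻¹' A) = μ (Prod.mk x ⁻¹' A) := by
  rw [← hT.measure_preimage (measurable_prodMk_left hA).nullMeasurableSet]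
  congr 1
  ext y
  exact Set.ext_iff.1 hAT (x, y)

/-- An `L²` eigenfunction of a weakly mixing ergodic transformation is constant. -/
lemma WeaklyMixing.ae_const_of_eigenvector (hT : Ergodic T μ) (hW : WeaklyMixing T μ)
    {z : ℂ} {f : Lp ℂ 2 μ}
    (hf : Lp.compMeasurePreservingₗᵢ ℂ T hT.toMeasurePreserving f = z • f) :
    ∃ c : ℂ, ∀ᵐ x ∂μ, f x = c := by
  rcases eq_or_ne f 0 with rfl | hf0
  · exact ⟨0, Lp.coeFn_zero _ _ _⟩
  have hz : ‖z‖ = 1 := by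
    have := congrArg norm hf
    rw [LinearIsometry.norm_map, norm_smul] at this
    exact (mul_eq_right₀ (norm_ne_zero_iff.2 hf0)).1 this.symm
  have hcomp : ∀ᵐ x ∂μ, f (T x) = z * f x := by
    have h1 : Lp.compMeasurePreservingₗᵢ ℂ T hT.toMeasurePreserving f =ᵐ[μ] f ∘ T :=
      Lp.coeFn_compMeasurePreserving f hT.toMeasurePreserving
    rw [hf] at h1
    filter_upwards [h1, Lp.coeFn_smul z f] with x hx hx'
    rw [Function.comp_apply] at hx
    rw [← hx, hx', Pi.smul_apply, smul_eq_mul]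
  -- `WeaklyMixing` only covers bounded functions; ergodicity makes the invariant modulus constant.
  have hnorm : (fun x => ‖f x‖) ∘ T =ᵐ[μ] fun x => ‖f x‖ := by
    filter_upwards [hcomp] with x hx
    simp [hx, hz]
  obtain ⟨c, hc⟩ := hT.ae_eq_const_of_ae_eq_comp_ae
    (Lp.aestronglyMeasurable f).norm hnorm
  exact hW z f (memLp_top_of_bound (Lp.aestronglyMeasurable f) c (hc.mono fun x hx => hx.le)) hcomp

variable [IsFiniteMeasure μ]

/-- The indicator function of the section of `A` at `x`, as an element of `L²`. -/
noncomputable def sectionIndicator (μ : Measure X) [IsFiniteMeasure μ] {A : Set (X × X)}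
    (hA : MeasurableSet A) (x : X) : Lp ℂ 2 μ :=
  indicatorConstLp 2 (measurable_prodMk_left (x := x) hA) (measure_ne_top μ _) (1 : ℂ)

lemma measurable_sectionIndicator [MeasurableSpace.CountablyGenerated X]
    [MeasurableSpace (Lp ℂ 2 μ)] [BorelSpace (Lp ℂ 2 μ)] {A : Set (X × X)}
    (hA : MeasurableSet A) : Measurable (sectionIndicator μ hA) := by
  refine measurable_of_edist fun g => ?_
  have key : ∀ x, edist (sectionIndicator μ hA x) g =
      (∫⁻ y, ‖A.indicator (fun _ => (1 : ℂ)) (x, y) - g y‖ₑ ^ (2 : ℝ) ∂μ) ^ (1 / (2 : ℝ)) := by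
    intro x
    rw [Lp.edist_def, eLpNorm_eq_lintegral_rpow_enorm_toReal (by simp) (by simp)]
    simp only [ENNReal.toReal_ofNat]
    congr 1
    refine lintegral_congr_ae ?_
    filter_upwards [indicatorConstLp_coeFn (p := 2) (hs := measurable_prodMk_left (x := x) hA)
      (hμs := measure_ne_top μ _) (c := (1 : ℂ))] with y hy
    rw [Pi.sub_apply, sectionIndicator, hy]
    rfl
  simp only [key]
  have hg : Measurable g := (Lp.stronglyMeasurable g).measurable
  refine Measurable.pow_const ?_ _
  refine Measurable.lintegral_prod_right' (f := fun p : X × X =>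
    ‖A.indicator (fun _ => (1 : ℂ)) p - g p.2‖ₑ ^ (2 : ℝ)) ?_
  exact (((measurable_const.indicator hA).sub (hg.comp measurable_snd)).enorm).pow_const _

lemma compMeasurePreserving_sectionIndicator (hT : MeasurePreserving T μ μ) {A : Set (X × X)}
    (hA : MeasurableSet A) (hAT : Prod.map T T ⁻¹' A = A) (x : X) :
    Lp.compMeasurePreservingₗᵢ ℂ T hT (sectionIndicator μ hA (T x)) = sectionIndicator μ hA x := by
  change Lp.compMeasurePreserving T hT _ = _
  rw [sectionIndicator, Lp.indicatorConstLp_compMeasurePreserving]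
  congr 1
  ext y
  exact Set.ext_iff.1 hAT (x, y)

/-- A weakly mixing ergodic transformation is doubly ergodic. -/
theorem WeaklyMixing.ergodic_prodMap [MeasurableSpace.CountablyGenerated X]
    (hT : Ergodic T μ) (hW : WeaklyMixing T μ) :
    Ergodic (Prod.map T T) (μ.prod μ) := by
  have hTT : MeasurePreserving (Prod.map T T) (μ.prod μ) (μ.prod μ) :=
    hT.toMeasurePreserving.prod hT.toMeasurePreserving
  refine ⟨hTT, ⟨fun A hA hAT => ?_⟩⟩
  rw [eventuallyConst_set]
  borelize ↥(Lp ℂ 2 μ)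
  let U := Lp.compMeasurePreservingₗᵢ (p := 2) (E := ℂ) ℂ T hT.toMeasurePreserving
  let one : Lp ℂ 2 μ := indicatorConstLp 2 MeasurableSet.univ (measure_ne_top μ _) (1 : ℂ)
  let m : X → ℝ := fun x => μ.real (Prod.mk x ⁻¹' A) / μ.real Set.univ
  have hm : Measurable m := (measurable_measure_prodMk_left hA).ennreal_toReal.div_const _
  have hm1 (x : X) : |m x| ≤ 1 := by
    rw [abs_of_nonneg (by positivity)]
    exact div_le_one_of_le₀ (measureReal_mono (Set.subset_univ _)) (by positivity)
  -- The coefficient `m x` is chosen to make `Φ x` orthogonal to constants.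
  let Φ : X → Lp ℂ 2 μ := fun x => sectionIndicator μ hA x - (m x : ℂ) • one
  have hΦm : AEStronglyMeasurable Φ μ := by
    refine AEStronglyMeasurable.sub ?_ ?_
    · exact (measurable_sectionIndicator hA).aestronglyMeasurable
    · exact (Complex.measurable_ofReal.comp hm).aestronglyMeasurable.smul_const one
  have hUone : U one = one := by
    change Lp.compMeasurePreserving T hT.toMeasurePreserving _ = _
    rw [Lp.indicatorConstLp_compMeasurePreserving]
    rfl
  have hΦb : ∀ᵐ x ∂μ, ‖Φ x‖ ≤ ‖one‖ + 1 * ‖one‖ := .of_forall fun x => by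
    refine (norm_sub_le _ _).trans (add_le_add ?_ ?_)
    · simp only [sectionIndicator, one, norm_indicatorConstLp two_ne_zero ENNReal.ofNat_ne_top]
      gcongr
      · exact measure_ne_top _ _
      · exact Set.subset_univ _
    · rw [norm_smul]
      gcongr
      simpa using hm1 x
  have hΦU : ∀ᵐ x ∂μ, U (Φ (T x)) = Φ x := .of_forall fun x => by
    simp only [Φ, map_sub, map_smul, hUone, m, Measure.real,
      measure_section_comp hT.toMeasurePreserving hA hAT]
    rw [compMeasurePreserving_sectionIndicator hT.toMeasurePreserving hA hAT]
  have hΦ0 : Φ =ᵐ[μ] 0 := by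
    refine ae_eq_zero_of_orthogonal_eigenvectors hT.toMeasurePreserving U hΦm hΦb hΦU
      fun z f hf => .of_forall fun x => ?_
    obtain ⟨c, hc⟩ := hW.ae_const_of_eigenvector hT hf
    have hI (s : Set X) : ∫ y in s, f y ∂μ = μ.real s * c := by
      rw [integral_congr_ae (ae_restrict_of_ae hc)]
      simp
    rw [inner_sub_left, inner_smul_left, sectionIndicator, L2.inner_indicatorConstLp_one,
      L2.inner_indicatorConstLp_one, hI, hI, Complex.conj_ofReal, ← mul_assoc,
      ← Complex.ofReal_mul, div_mul_cancel_of_imp, sub_self]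
    -- If the total mass is zero, so is the numerator, and division by zero is harmless.
    intro h
    exact le_antisymm (h ▸ measureReal_mono (Set.subset_univ _)) measureReal_nonneg
  have h01 : ∀ᵐ x ∂μ, μ (Prod.mk x ⁻¹' A) = 0 ∨ μ (Prod.mk x ⁻¹' A)ᶜ = 0 := by
    filter_upwards [hΦ0] with x hx
    have h1 : sectionIndicator μ hA x = (m x : ℂ) • one := sub_eq_zero.1 hx
    have h2 : ∀ᵐ y ∂μ, (Prod.mk x ⁻¹' A).indicator (fun _ => (1 : ℂ)) y = m x := by
      have h3 := indicatorConstLp_coeFn (μ := μ) (p := 2)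
        (hs := measurable_prodMk_left (x := x) hA) (hμs := measure_ne_top μ _) (c := (1 : ℂ))
      have h4 := Lp.coeFn_smul (m x : ℂ) one
      rw [← h1] at h4
      filter_upwards [h3, h4, indicatorConstLp_coeFn (μ := μ) (p := 2)
        (hs := MeasurableSet.univ) (hμs := measure_ne_top μ _) (c := (1 : ℂ))] with y h3 h4 h5
      rw [← h3]
      refine h4.trans ?_
      rw [Pi.smul_apply, h5]
      simp
    by_cases hmx : m x = 0
    · left
      refine measure_mono_null (fun y hy => ?_) h2
      simpa [hmx] using hy
    · right
      refine measure_mono_null (fun y hy => ?_) h2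
      simpa [Set.indicator_of_notMem hy] using fun h => hmx (Complex.ofReal_eq_zero.1 h.symm)
  -- The points with null section form a `T`-invariant set.
  have hs : MeasurableSet {x | μ (Prod.mk x ⁻¹' A) = 0} :=
    measurable_measure_prodMk_left hA (measurableSet_singleton 0)
  rcases hT.ae_mem_or_ae_notMem hs (by
    ext x
    simp [measure_section_comp hT.toMeasurePreserving hA hAT]) with h | h
  · right
    rw [ae_iff]
    simp only [not_not, Set.ofPred_mem_eq]
    rw [Measure.measure_prod_null hA]
    exact h
  · left
    change μ.prod μ Aᶜ = 0
    rw [Measure.measure_prod_null hA.compl]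
    filter_upwards [h, h01] with x hx hx'
    exact hx'.resolve_left hx

end Sections

/-! ### Double ergodicity implies Li-Yorke sensitivity -/

section Ergodic

/-- Almost every orbit of a finite measure preserving ergodic system visits a given set of
positive measure infinitely often. -/
lemma ae_frequently_mem_of_ergodic {Y : Type*} [MeasurableSpace Y] {ν : Measure Y}
    [IsFiniteMeasure ν] {S : Y → Y} (hS : Ergodic S ν) {s : Set Y} (hs : MeasurableSet s)
    (h0 : ν s ≠ 0) : ∀ᵐ y ∂ν, ∃ᶠ n in atTop, S^[n] y ∈ s := by
  have hm : MeasurableSet {y | ∃ᶠ n in atTop, S^[n] y ∈ s} := by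
    have : {y | ∃ᶠ n in atTop, S^[n] y ∈ s} = limsup (fun n => S^[n] ⁻¹' s) atTop := by
      rw [limsup_eq_iInf_iSup_of_nat]
      ext y
      simp [frequently_atTop]
    rw [this]
    exact .measurableSet_limsup fun n => hS.measurable.iterate n hs
  -- Infinitely many visits is a shift-invariant condition; Poincaré recurrence rules out the null
  -- alternative.
  refine (hS.ae_mem_or_ae_notMem hm ?_).resolve_right fun h => h0 ?_
  · ext y
    simp only [Set.mem_preimage, Set.mem_ofPred_eq, ← Function.iterate_succ_apply]
    conv_rhs => rw [← map_add_atTop_eq_nat 1, frequently_map]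
  · rw [← compl_compl s, ← mem_ae_iff]
    filter_upwards [h, hS.toMeasurePreserving.conservative.ae_mem_imp_frequently_image_mem
      hs.nullMeasurableSet] with y h1 h2 h3
    exact h1 (h2 h3)

lemma isLiYorkePair_of_frequently {X : Type*} [MetricSpace X] {T : X → X} (hd : ∀ x y : X, dist x y ≤ 1) {x y : X} {δ : ℝ}
    (hδ : 0 < δ) (h0 : ∀ n : ℕ, ∃ᶠ k in atTop, dist (T^[k] x) (T^[k] y) < 1 / (n + 1 : ℝ))
    (h1 : ∃ᶠ k in atTop, δ < dist (T^[k] x) (T^[k] y)) : IsLiYorkePair T x y := by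
  have hle : IsBoundedUnder (· ≤ ·) atTop fun n => dist (T^[n] x) (T^[n] y) :=
    isBoundedUnder_of ⟨1, fun n => hd _ _⟩
  have hge : IsBoundedUnder (· ≥ ·) atTop fun n => dist (T^[n] x) (T^[n] y) :=
    isBoundedUnder_of ⟨0, fun n => dist_nonneg⟩
  refine ⟨le_antisymm ?_ ?_, ?_⟩
  · refine ge_of_tendsto' tendsto_one_div_add_atTop_nhds_zero_nat fun n => ?_
    exact liminf_le_of_frequently_le ((h0 n).mono fun k hk => hk.le) hge
  · exact le_liminf_of_le hle.isCoboundedUnder_ge (.of_forall fun n => dist_nonneg)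
  · exact hδ.trans_le (le_limsup_of_frequently_le (h1.mono fun k hk => hk.le) hle)

variable {X : Type*} [MeasurableSpace X] {μ : Measure X} [IsFiniteMeasure μ] {T : X → X}

lemma IsCompatibleMetric.prod_dist_lt_ne_zero [MetricSpace X] (hμ : μ ≠ 0)
    (hd : IsCompatibleMetric μ) {ε : ℝ} (hε : 0 < ε) :
    (μ.prod μ) {p | dist p.1 p.2 < ε} ≠ 0 := by
  have hm : MeasurableSet {p : X × X | dist p.1 p.2 < ε} :=
    measurableSet_lt hd.measurable_dist measurable_const
  rw [Ne, Measure.measure_prod_null hm]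
  intro h
  have : ∀ᵐ x ∂μ, False := by
    filter_upwards [h] with x hx
    refine (hd.ball_pos x ε hε).ne' ?_
    convert! hx using 2
    ext y
    simp [dist_comm]
  rw [eventually_false_iff_eq_bot, ae_eq_bot] at this
  exact hμ this

/-- Otherwise the diagonal is conull, and by Fubini some singleton carries all the mass. -/
lemma exists_prod_lt_dist_ne_zero [NullSingletonClass μ] [MetricSpace X]
    (hμ : μ ≠ 0) : ∃ δ > 0, (μ.prod μ) {p | δ < dist p.1 p.2} ≠ 0 := by
  by_contra! h
  have h1 : ∀ᵐ p ∂μ.prod μ, p.1 = p.2 := by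
    have : ∀ n : ℕ, ∀ᵐ p ∂μ.prod μ, dist p.1 p.2 ≤ 1 / (n + 1) := fun n => by
      have := h (1 / (n + 1)) (by positivity)
      rw [ae_iff]
      simpa using this
    filter_upwards [ae_all_iff.2 this] with p hp
    refine dist_le_zero.1 (ge_of_tendsto' tendsto_one_div_add_atTop_nhds_zero_nat hp)
  have h2 : ∀ᵐ x ∂μ, ∀ᵐ y ∂μ, x = y := Measure.ae_ae_of_ae_prod h1
  have : ∀ᵐ x ∂μ, False := by
    filter_upwards [h2] with x hx
    refine hμ (Measure.measure_univ_eq_zero.1 ?_)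
    refine measure_mono_null (t := {x} ∪ {y | ¬ x = y}) (fun y _ => ?_)
      (measure_union_null (measure_singleton x) hx)
    by_cases hxy : x = y
    · exact Or.inl hxy.symm
    · exact Or.inr hxy
  rw [eventually_false_iff_eq_bot, ae_eq_bot] at this
  exact hμ this

theorem liYorkeMSensitive_of_ergodic_prodMap [NullSingletonClass μ]
    (hTT : Ergodic (Prod.map T T) (μ.prod μ)) : LiYorkeMSensitive T μ := by
  intro _ hd
  rcases eq_or_ne μ 0 with rfl | hμ
  · simp [LiYorkeMSensitiveFor]
  obtain ⟨δ, hδ, hδ0⟩ := exists_prod_lt_dist_ne_zero hμ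
  have h1 := ae_frequently_mem_of_ergodic hTT
    (measurableSet_lt measurable_const hd.measurable_dist) hδ0
  have h0 : ∀ n : ℕ, _ := fun n => ae_frequently_mem_of_ergodic hTT
    (measurableSet_lt hd.measurable_dist measurable_const)
    (hd.prod_dist_lt_ne_zero hμ (Nat.one_div_pos_of_nat (n := n)))
  filter_upwards [h1, ae_all_iff.2 h0] with p hp1 hp0
  simp only [Prod.map_iterate] at hp1 hp0
  exact isLiYorkePair_of_frequently hd.dist_le_one hδ hp0 hp1

end Ergodic

/-! ### Moving a null set into a conull set -/

section NullModification

variable {X : Type*} [MeasurableSpace X] [StandardBorelSpace X] {μ : Measure X}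

/-- An uncountable Borel set contains an uncountable null Borel set. -/
lemma exists_uncountable_null_subset [SFinite μ] {S : Set X} (hS : MeasurableSet S)
    (hunc : ¬ S.Countable) : ∃ C ⊆ S, MeasurableSet C ∧ ¬ C.Countable ∧ μ C = 0 := by
  have : StandardBorelSpace S := hS.standardBorel
  have hS' : ¬ Countable S := hunc
  let e : S ≃ᵐ ℝ × ℝ := PolishSpace.measurableEquivOfNotCountable hS' (by
    rw [not_countable_iff]; infer_instance)
  -- Uncountably many disjoint uncountable lines: only countably many can have positive measure.
  let A : ℝ → Set X := fun a => Subtype.val '' (e ⁻¹' (Prod.fst ⁻¹' {a}))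
  have hA (a : ℝ) : MeasurableSet (A a) :=
    hS.subtype_image (e.measurable (measurable_fst (measurableSet_singleton a)))
  have hdisj : Pairwise (Function.onFun Disjoint A) := by
    intro a b hab
    refine Set.disjoint_image_of_injective Subtype.val_injective ?_
    refine Disjoint.preimage _ (Disjoint.preimage _ ?_)
    simpa using hab
  have hcount := Measure.countable_meas_pos_of_disjoint_iUnion (μ := μ) hA hdisj
  obtain ⟨a, ha⟩ : ∃ a, a ∉ {a | 0 < μ (A a)} := by
    by_contra! h
    exact Set.not_countable_univ (hcount.mono fun a _ => h a)
  refine ⟨A a, Subtype.coe_image_subset S _, hA a, fun hc => ?_, by simpa using ha⟩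
  have hinj : Function.Injective fun b : ℝ => (e.symm (a, b) : X) := fun b b' h => by
    simpa using e.symm.injective (Subtype.val_injective h)
  refine Set.not_countable_univ (α := ℝ) ((hc.preimage hinj).mono fun b _ => ?_)
  exact ⟨e.symm (a, b), by simp, rfl⟩

/-- A conull Borel set of a nonatomic standard Borel space receives a measurable injection of the
whole space that is the identity almost everywhere. -/
lemma exists_injective_ae_eq_id [IsFiniteMeasure μ] [NullSingletonClass μ] (hμ : μ ≠ 0) {S : Set X}
    (hS : MeasurableSet S) (hSμ : μ Sᶜ = 0) :
    ∃ Ψ : X → X, Measurable Ψ ∧ Function.Injective Ψ ∧ (∀ x, Ψ x ∈ S) ∧ ∀ᵐ x ∂μ, Ψ x = x := by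
  classical
  have hunc : ¬ S.Countable := fun h => hμ <| by
    rw [← Measure.measure_univ_eq_zero, ← Set.union_compl_self S]
    exact measure_union_null (h.measure_zero μ) hSμ
  obtain ⟨C, hCS, hC, hCunc, hC0⟩ := exists_uncountable_null_subset (μ := μ) hS hunc
  -- Including `C` in the moved set vacates it, so mapping `N` onto `C` keeps `Ψ` injective.
  let N : Set X := Sᶜ ∪ C
  have hN : MeasurableSet N := hS.compl.union hC
  have : StandardBorelSpace N := hN.standardBorel
  have : StandardBorelSpace C := hC.standardBorel
  let ψ : N ≃ᵐ C := PolishSpace.measurableEquivOfNotCountable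
    (fun h => hCunc (Set.Countable.mono Set.subset_union_right h)) hCunc
  let Ψ : X → X := fun x => if h : x ∈ N then ψ ⟨x, h⟩ else x
  have hΨN {x : X} (h : x ∈ N) : Ψ x = ψ ⟨x, h⟩ := dif_pos h
  have hΨ {x : X} (h : x ∉ N) : Ψ x = x := dif_neg h
  refine ⟨Ψ, ?_, fun x y hxy => ?_, fun x => ?_, ?_⟩
  · exact Measurable.dite (measurable_subtype_coe.comp ψ.measurable) measurable_subtype_coe hN
  · by_cases hx : x ∈ N <;> by_cases hy : y ∈ N
    · rw [hΨN hx, hΨN hy] at hxy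
      simpa using ψ.injective (Subtype.val_injective hxy)
    · rw [hΨN hx, hΨ hy] at hxy
      exact (hy (hxy ▸ Or.inr (ψ ⟨x, hx⟩).2)).elim
    · rw [hΨ hx, hΨN hy] at hxy
      exact (hx (hxy ▸ Or.inr (ψ ⟨y, hy⟩).2)).elim
    · rwa [hΨ hx, hΨ hy] at hxy
  · by_cases hx : x ∈ N
    · rw [hΨN hx]
      exact hCS (ψ ⟨x, hx⟩).2
    · rw [hΨ hx]
      by_contra h
      exact hx (Or.inl h)
  · have hN0 : μ N = 0 := measure_union_null hSμ hC0
    filter_upwards [measure_eq_zero_iff_ae_notMem.1 hN0] with x hx using hΨ hx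

end NullModification

/-! ### Compatible metrics adapted to a function -/

/-- The metric induced by an injection into a metric space, truncated at `1`. -/
noncomputable abbrev truncatedMetricSpace {X Z : Type*} [MetricSpace Z] (g : X → Z)
    (hg : Function.Injective g) : MetricSpace X where
  dist x y := min 1 (dist (g x) (g y))
  dist_self x := by simp
  dist_comm x y := by simp only [dist_comm]
  dist_triangle x y z := by
    have h1 := dist_triangle (g x) (g y) (g z)
    have h2 := dist_nonneg (x := g x) (y := g y)
    have h3 := dist_nonneg (x := g y) (y := g z)
    rcases min_cases 1 (dist (g x) (g y)) with h | h <;>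
    rcases min_cases 1 (dist (g y) (g z)) with h' | h' <;>
    rcases min_cases 1 (dist (g x) (g z)) with h'' | h'' <;> linarith
  eq_of_dist_eq_zero {x y} h := by
    change min 1 (dist (g x) (g y)) = 0 at h
    rcases min_choice 1 (dist (g x) (g y)) with h' | h'
    · simp [h'] at h
    · rw [h'] at h
      exact hg (dist_eq_zero.1 h)

/-- Every measurable function on a nonatomic standard Borel space is almost everywhere dominated,
up to truncation, by a compatible metric. -/
lemma exists_isCompatibleMetric_ge {X : Type*} [MeasurableSpace X] [StandardBorelSpace X]
    {μ : Measure X} [IsFiniteMeasure μ] [NullSingletonClass μ] (hμ : μ ≠ 0) {f : X → ℂ}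
    (hf : Measurable f) : ∃ _ : MetricSpace X, IsCompatibleMetric μ ∧
      ∃ s : Set X, (∀ᵐ x ∂μ, x ∈ s) ∧ ∀ x ∈ s, ∀ y ∈ s, min 1 ‖f x - f y‖ ≤ dist x y := by
  -- The first coordinate gives injectivity; the second makes the sup distance dominate that of `f`.
  let e : X → ℝ × ℂ := fun x => (embeddingReal X x, f x)
  have heR := measurableEmbedding_embeddingReal X
  have he : Measurable e := heR.measurable.prodMk hf
  have hei : Function.Injective e := fun x y h => heR.injective (Prod.ext_iff.1 h).1
  -- Balls around points outside `S` could be null, so `Ψ` sends all points into `S`.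
  let S : Set X := e ⁻¹' (μ.map e).support
  have hS : MeasurableSet S := he Measure.isClosed_support.measurableSet
  have hS0 : μ Sᶜ = 0 := by
    have h : (μ.map e).support ∈ ae (μ.map e) := Measure.support_mem_ae
    rw [mem_ae_iff, Measure.map_apply he Measure.isClosed_support.measurableSet.compl] at h
    exact h
  obtain ⟨Ψ, hΨ, hΨi, hΨS, hΨae⟩ := exists_injective_ae_eq_id hμ hS hS0
  let d := truncatedMetricSpace (e ∘ Ψ) (hei.comp hΨi)
  have hdist (x y : X) : dist x y = min 1 (dist (e (Ψ x)) (e (Ψ y))) := rfl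
  refine ⟨d, ⟨?_, fun x y => min_le_left _ _, fun x r hr => ?_⟩, {x | Ψ x = x}, hΨae, ?_⟩
  · simp only [hdist]
    have he' : Measurable fun x => e (Ψ x) := he.comp hΨ
    exact measurable_const.min ((he'.comp measurable_fst).dist (he'.comp measurable_snd))
  · have hpos : 0 < (μ.map e) (Metric.ball (e (Ψ x)) r) :=
      (Measure.mem_support_iff_forall _).1 (hΨS x) _ (Metric.ball_mem_nhds _ hr)
    rw [Measure.map_apply he measurableSet_ball] at hpos
    refine hpos.trans_le (measure_mono_ae ?_)
    filter_upwards [hΨae] with y hy hy'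
    change dist y x < r
    rw [hdist, hy]
    exact (min_le_right _ _).trans_lt hy'
  · intro x hx y hy
    rw [hdist, show Ψ x = x from hx, show Ψ y = y from hy]
    refine min_le_min_left _ ?_
    rw [← dist_eq_norm]
    exact le_max_right _ _

/-! ### Li-Yorke sensitivity implies weak mixing -/

variable {X : Type*} [MeasurableSpace X] {μ : Measure X} {T : X → X}

lemma norm_eq_one_of_eigenfunction (hT : MeasurePreserving T μ μ) {z : ℂ} {f : X → ℂ}
    (hf : MemLp f ⊤ μ) (hz : ∀ᵐ x ∂μ, f (T x) = z * f x) (hf0 : ¬ f =ᵐ[μ] 0) : ‖z‖ = 1 := by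
  have h1 : eLpNorm (f ∘ T) ⊤ μ = eLpNorm f ⊤ μ := eLpNorm_comp_measurePreserving hf.1 hT
  have h2 : f ∘ T =ᵐ[μ] z • f := hz
  rw [eLpNorm_congr_ae h2, eLpNorm_const_smul] at h1
  have h3 := congrArg ENNReal.toReal h1
  rw [ENNReal.toReal_mul, toReal_enorm] at h3
  refine (mul_eq_right₀ fun h => hf0 ?_).1 h3
  rw [ENNReal.toReal_eq_zero_iff] at h
  exact (eLpNorm_eq_zero_iff hf.1 ENNReal.top_ne_zero).1 (h.resolve_right hf.2.ne)

theorem LiYorkeMSensitive.weaklyMixing [StandardBorelSpace X] [IsFiniteMeasure μ]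
    [NullSingletonClass μ] (hT : MeasurePreserving T μ μ) (hL : LiYorkeMSensitive T μ) :
    WeaklyMixing T μ := by
  intro z f₀ hf₀ hz₀
  rcases eq_or_ne μ 0 with rfl | hμ
  · simp
  by_cases hf0 : f₀ =ᵐ[μ] 0
  · exact ⟨0, hf0⟩
  have hz1 := norm_eq_one_of_eigenfunction hT hf₀ hz₀ hf0
  -- The metric must be measurable everywhere, so a measurable representative is needed.
  let f := hf₀.1.mk f₀
  have hf : Measurable f := hf₀.1.stronglyMeasurable_mk.measurable
  have hff : f₀ =ᵐ[μ] f := hf₀.1.ae_eq_mk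
  have hz : ∀ᵐ x ∂μ, f (T x) = z * f x := by
    filter_upwards [hz₀, hff, hT.quasiMeasurePreserving.ae hff] with x h1 h2 h3
    rw [← h2, ← h3, h1]
  obtain ⟨d, hd, s, hs, hds⟩ := exists_isCompatibleMetric_ge hμ hf
  have hgood : ∀ᵐ x ∂μ, ∀ n : ℕ, T^[n] x ∈ s ∧ f (T^[n] x) = z ^ n * f x := by
    have h1 : ∀ᵐ x ∂μ, ∀ n : ℕ, T^[n] x ∈ s ∧ f (T (T^[n] x)) = z * f (T^[n] x) :=
      ae_all_iff.2 fun n => (hT.iterate n).quasiMeasurePreserving.ae (hs.and hz)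
    filter_upwards [h1] with x hx n
    refine ⟨(hx n).1, ?_⟩
    induction n with
    | zero => simp
    | succ n ih => rw [Function.iterate_succ_apply', (hx n).2, ih, pow_succ']; ring
  have hpair : ∀ᵐ p ∂μ.prod μ, f p.2 = f p.1 := by
    filter_upwards [hL hd, Measure.quasiMeasurePreserving_fst.ae hgood,
      Measure.quasiMeasurePreserving_snd.ae hgood] with p hp h1 h2
    have hle (n : ℕ) : min 1 ‖f p.1 - f p.2‖ ≤ dist (T^[n] p.1) (T^[n] p.2) := by
      refine le_trans (le_of_eq ?_) (hds _ (h1 n).1 _ (h2 n).1)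
      rw [(h1 n).2, (h2 n).2, ← mul_sub, norm_mul, norm_pow, hz1, one_pow, one_mul]
    have hco : IsCoboundedUnder (· ≥ ·) atTop fun n => dist (T^[n] p.1) (T^[n] p.2) :=
      (isBoundedUnder_of ⟨1, fun n => hd.dist_le_one _ _⟩ :
        IsBoundedUnder (· ≤ ·) _ _).isCoboundedUnder_ge
    have h0 := hp.1 ▸ le_liminf_of_le hco (.of_forall hle)
    have h0' : ‖f p.1 - f p.2‖ ≤ 0 := by
      rcases min_le_iff.1 h0 with h | h
      · norm_num at h
      · exact h
    exact (sub_eq_zero.1 (norm_le_zero_iff.1 h0')).symm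
  have : (ae μ).NeBot := ae_neBot.2 hμ
  obtain ⟨x, hx⟩ := (Measure.ae_ae_of_ae_prod hpair).exists
  refine ⟨f x, ?_⟩
  filter_upwards [hx, hff] with y hy hy'
  rw [hy', hy]

end MeasurableLiYorke

theorem mainTheorem2 {X : Type*} [MeasurableSpace X] [StandardBorelSpace X]
    (μ : Measure X) [IsFiniteMeasure μ] [NullSingletonClass μ] (T : X → X) (hT : Ergodic T μ) :
    MeasurableLiYorke.LiYorkeMSensitive T μ ↔ MeasurableLiYorke.WeaklyMixing T μ := by
  refine ⟨fun h => h.weaklyMixing hT.toMeasurePreserving, fun h => ?_⟩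
  exact MeasurableLiYorke.liYorkeMSensitive_of_ergodic_prodMap (h.ergodic_prodMap hT)
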